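/- Let $L\ge 1$ be an integer and let $V_{\sqrt L\,\mathbb Z}=\bigoplus_{m\in\mathbb Z}F_{m\sqrt L}$ be the one-dimensional lattice vertex superalgebra, where $F_\mu$ is the complex Fock module of the Heisenberg algebra $[a_n,a_m]=n\,\delta_{n+m,0}$ with highest weight vector $|\mu\rangle$, $a_0|\mu\rangle=\mu|\mu\rangle$, $a_n|\mu\rangle=0$ for $n>0$. Let $$V_{\sqrt L}(z)=e^{\sqrt L\,q}\,z^{\sqrt L\,a_0}\exp\Big(-\sqrt L\sum_{n<0}\frac{a_n}{n}z^{-n}\Big)\exp\Big(-\sqrt L\sum_{n>0}\frac{a_n}{n}z^{-n}\Big),$$ where $e^{\sqrt L\,q}$ maps $|\mu\rangle$ to $|\mu+\sqrt L\rangle$ and commutes with $a_n$, $n\neq 0$. Define the modes $e_n$ by $V_{\sqrt{2N}}(z)=\sum_{n\in\mathbb Z}e_n z^{-n-N}$ for $L=2N$, and the modes $\theta_n$ by $V_{\sqrt{2N+1}}(z)=\sum_{n\in\mathbb Z}\theta_n z^{-n}$ for $L=2N+1$; the $e_n$ commute and the $\theta_n$ anticommute. For a set $S\subseteq\mathbb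 Z$, let $\mathbb C[e_i\mid i\in S]$ and $\mathbb C\{\theta_i\mid i\in S\}$ be the unital algebras of operators generated by the $e_i$, respectively the $\theta_i$, with $i\in S$. For an integer $l\geq 0$ let $\mathbb C^F_l[e_i\mid i\in S]$ be the space of Fibonacci-$l$ polynomials, i.e. the linear span of the monomials $e_{j_1}e_{j_2}\cdots e_{j_k}$ ($k\ge 0$) with $j_1,\dots,j_k\in S$ and $j_m-j_{m-1}>l$ for $m=2,\dots,k$; define $\mathbb C^F_l\{\theta_i\mid i\in S\}$ in the same way. The basic subspaces are $$W_j^{\sqrt{2N}}=\mathbb C[e_i\mid i\in\mathbb Z]\,|j\sqrt{2N}\rangle,\qquad W_j^{\sqrt{2N+1}}=\mathbb C\{\theta_i\mid i\in\mathbb Z\}\,|j\sqrt{2N+1}\rangle .$$ **Lemma.** For every integer $N\ge 1$ and every $j\in\mathbb Z$, $$W_j^{\sqrt{2N}}=\mathbb C[e_i\mid i\le -2Nj-N]\,|j\sqrt{2N}\rangle=\mathbb C^F_{2N-1}[e_i\mid i\le -2Nj-N]\,|j\sqrt{2N}\rangle ,$$ and for every integer $N\ge 0$ and every $j\in\mathbb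 Z$, $$W_j^{\sqrt{2N+1}}=\mathbb C\{\theta_i\mid i\le -j(2N+1)\}\,|j\sqrt{2N+1}\rangle=\mathbb C^F_{2N}\{\theta_i\mid i\le -j(2N+1)\}\,|j\sqrt{2N+1}\rangle .$$ -/

import Mathlib

open scoped Nat

noncomputable section

namespace LatticeVA

/-- The underlying space of every Fock module `F_ν` of the Heisenberg algebra: polynomials in
countably many variables, the variable with index `k` standing for the creation operator
`a₋₍ₖ₊₁₎`, and the polynomial `1` for the highest weight vector. -/
abbrev Fock : Type := MvPolynomial ℕ ℂ

/-- The Heisenberg mode `aₙ` acting on the Fock module `F_ν`, where `[aₙ, aₘ] = n δ_{n+m,0}`: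
multiplication by the variable for `n < 0`, the scalar `ν` for `n = 0`, and `n` times the partial
derivative for `n > 0`. -/
def heis (ν : ℂ) : ℤ → Module.End ℂ Fock
  | Int.ofNat 0 => ν • LinearMap.id
  | Int.ofNat (k + 1) => ((k : ℂ) + 1) • (MvPolynomial.pderiv k).toLinearMap
  | Int.negSucc k => LinearMap.mulLeft ℂ (MvPolynomial.X k)

/-- The exponential `∑ₘ gᵐ / m!` of a formal power series with zero constant coefficient, over a
possibly noncommutative algebra. Only `m ≤ n` contributes to the coefficient of `tⁿ`. -/
def expSeries {A : Type*} [Ring A] [Algebra ℂ A] (g : PowerSeries A) : PowerSeries A :=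
  PowerSeries.mk fun n =>
    ∑ m ∈ Finset.range (n + 1), ((m ! : ℂ)⁻¹) • PowerSeries.coeff n (g ^ m)

/-- The series `exp (- μ ∑_{n < 0} (aₙ / n) z⁻ⁿ)` on `F_ν`, as a power series in `z`
(with `n = -k`). -/
def creationExp (μ ν : ℂ) : PowerSeries (Module.End ℂ Fock) :=
  expSeries (PowerSeries.mk fun k =>
    if k = 0 then 0 else (-μ / (-(k : ℂ))) • heis ν (-(k : ℤ)))

/-- The series `exp (- μ ∑_{n > 0} (aₙ / n) z⁻ⁿ)` on `F_ν`, as a power series in `z⁻¹`. -/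
def annihilationExp (μ ν : ℂ) : PowerSeries (Module.End ℂ Fock) :=
  expSeries (PowerSeries.mk fun k =>
    if k = 0 then 0 else (-μ / (k : ℂ)) • heis ν (k : ℤ))

/-- `T` lowers the weight by `n`, where `a₋₍ₖ₊₁₎` has weight `k + 1`. -/
def Lowers (n : ℕ) (T : Module.End ℂ Fock) : Prop :=
  ∀ (d : ℕ) (f : Fock), MvPolynomial.IsWeightedHomogeneous (fun k : ℕ => k + 1) f d →
    (∀ d', d' + n = d → MvPolynomial.IsWeightedHomogeneous (fun k : ℕ => k + 1) (T f) d') ∧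
      (d < n → T f = 0)

theorem Lowers.zero (n : ℕ) : Lowers n 0 := fun _ _ _ =>
  ⟨fun _ _ => MvPolynomial.isWeightedHomogeneous_zero _ _ _, fun _ => rfl⟩

theorem Lowers.one : Lowers 0 1 := fun d f hf =>
  ⟨fun d' h => by simpa [← h] using hf, fun h => absurd h (Nat.not_lt_zero d)⟩

theorem Lowers.add {n : ℕ} {S T : Module.End ℂ Fock} (hS : Lowers n S) (hT : Lowers n T) :
    Lowers n (S + T) := fun d f hf =>
  ⟨fun d' h => ((hS d f hf).1 d' h).add ((hT d f hf).1 d' h), fun h => by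
    simp [(hS d f hf).2 h, (hT d f hf).2 h]⟩

theorem Lowers.smul {n : ℕ} {T : Module.End ℂ Fock} (c : ℂ) (hT : Lowers n T) :
    Lowers n (c • T) := fun d f hf =>
  ⟨fun d' h => (MvPolynomial.weightedHomogeneousSubmodule ℂ (fun k : ℕ => k + 1) d').smul_mem c
    ((hT d f hf).1 d' h), fun h => by simp [(hT d f hf).2 h]⟩

theorem Lowers.mul {m n : ℕ} {S T : Module.End ℂ Fock} (hS : Lowers m S) (hT : Lowers n T) :
    Lowers (m + n) (S * T) := by
  intro d f hf
  rcases lt_or_ge d n with h | h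
  · have h0 : (S * T) f = 0 := by simp [(hT d f hf).2 h]
    exact ⟨fun d' h' => by omega, fun _ => h0⟩
  · have h1 := (hT d f hf).1 (d - n) (by omega)
    exact ⟨fun d' h' => (hS _ _ h1).1 d' (by omega), fun h' => (hS _ _ h1).2 (by omega)⟩

theorem Lowers.sum {ι : Type*} {n : ℕ} (s : Finset ι) (T : ι → Module.End ℂ Fock)
    (h : ∀ i ∈ s, Lowers n (T i)) : Lowers n (∑ i ∈ s, T i) :=
  Finset.sum_induction T (Lowers n) (fun _ _ => Lowers.add) (Lowers.zero n) h

theorem lowers_pderiv (k : ℕ) : Lowers (k + 1) (MvPolynomial.pderiv k).toLinearMap := by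
  intro d f hf
  refine ⟨fun d' h => hf.pderiv h, fun h => ?_⟩
  apply MvPolynomial.pderiv_eq_zero_of_notMem_vars
  intro hk
  obtain ⟨m, hm, hkm⟩ := (MvPolynomial.mem_vars_iff_mem_support k).1 hk
  have h1 := hf (MvPolynomial.mem_support_iff.1 hm)
  have h3 : (fun k : ℕ => k + 1) k ≤ Finsupp.weight (fun k : ℕ => k + 1) m :=
    Finsupp.le_weight_of_ne_zero' _ (by simpa using hkm)
  simp only at h3
  omega

theorem lowers_coeff_pow (g : PowerSeries (Module.End ℂ Fock))
    (hg : ∀ n, Lowers n (PowerSeries.coeff n g)) (m n : ℕ) :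
    Lowers n (PowerSeries.coeff n (g ^ m)) := by
  induction m generalizing n with
  | zero =>
    rw [pow_zero, PowerSeries.coeff_one]
    split_ifs with h
    · subst h; exact Lowers.one
    · exact Lowers.zero n
  | succ m ih =>
    rw [pow_succ, PowerSeries.coeff_mul]
    refine Lowers.sum _ _ fun p hp => ?_
    rw [← Finset.HasAntidiagonal.mem_antidiagonal.1 hp]
    exact (ih _).mul (hg _)

theorem lowers_annihilationExp (μ ν : ℂ) (n : ℕ) :
    Lowers n (PowerSeries.coeff n (annihilationExp μ ν)) := by
  rw [annihilationExp, expSeries, PowerSeries.coeff_mk]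
  refine Lowers.sum _ _ fun m _ => (lowers_coeff_pow _ (fun k => ?_) m n).smul _
  rw [PowerSeries.coeff_mk]
  split_ifs with h
  · exact Lowers.zero k
  · obtain ⟨k, rfl⟩ := Nat.exists_eq_succ_of_ne_zero h
    exact ((lowers_pderiv k).smul _).smul _

/-- Only finitely many coefficients of the annihilation part act nontrivially on a vector. -/
theorem annihilationExp_finite (μ ν : ℂ) (f : Fock) :
    {k : ℕ | PowerSeries.coeff k (annihilationExp μ ν) f ≠ 0}.Finite := by
  induction f using MvPolynomial.induction_on' with
  | monomial u a =>
    refine (Set.finite_Iic (Finsupp.weight (fun k : ℕ => k + 1) u)).subset fun k hk => ?_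
    by_contra h
    exact hk ((lowers_annihilationExp μ ν k _ _
      (MvPolynomial.isWeightedHomogeneous_monomial _ u a rfl)).2 (not_le.1 h))
  | add p q hp hq =>
    refine (hp.union hq).subset fun k hk => ?_
    by_contra h
    simp only [Set.mem_union, Set.mem_ofPred_eq, not_or, not_not] at h
    exact hk (by rw [map_add, h.1, h.2, add_zero])

/-- Coefficient of `zⁱ`, for an integer `i`, in a power series in `z`. -/
def zcoeff (g : PowerSeries (Module.End ℂ Fock)) (i : ℤ) : Module.End ℂ Fock :=
  if 0 ≤ i then PowerSeries.coeff i.toNat g else 0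

theorem normalOrdered_finite (μ ν : ℂ) (r : ℤ) (f : Fock) :
    (Function.support fun k : ℕ => zcoeff (creationExp μ ν) (r + k)
      (PowerSeries.coeff k (annihilationExp μ ν) f)).Finite :=
  (annihilationExp_finite μ ν f).subset fun k hk h => hk (by simp only [h, map_zero])

/-- The coefficient of `zʳ` in the product
`exp (- μ ∑_{n < 0} (aₙ / n) z⁻ⁿ) exp (- μ ∑_{n > 0} (aₙ / n) z⁻ⁿ)` acting on `F_ν`. The sum is
finite on every vector. -/
def normalOrdered (μ ν : ℂ) (r : ℤ) : Module.End ℂ Fock where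
  toFun f := ∑ᶠ k : ℕ, zcoeff (creationExp μ ν) (r + k)
    (PowerSeries.coeff k (annihilationExp μ ν) f)
  map_add' f g := by
    simp only [map_add]
    exact finsum_add_distrib (normalOrdered_finite μ ν r f) (normalOrdered_finite μ ν r g)
  map_smul' c f := by
    simp only [map_smul, RingHom.id_apply]
    exact (smul_finsum' c (normalOrdered_finite μ ν r f)).symm

/-- The space `V_{√L ℤ} = ⨁_{m ∈ ℤ} F_{m√L}`, the summand with index `m` being `F_{m√L}`. -/
abbrev Space : Type := ℤ →₀ Fock

/-- The highest weight vector `|j√L⟩`. -/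
def vac (j : ℤ) : Space := Finsupp.single j 1

/-- The coefficient of `zᵖ` in the vertex operator
`V_{√L}(z) = e^{√L q} z^{√L a₀} exp (- √L ∑_{n<0} (aₙ / n) z⁻ⁿ) exp (- √L ∑_{n>0} (aₙ / n) z⁻ⁿ)`.
On `F_{m√L}` the factor `z^{√L a₀}` is `z^{mL}`, and `e^{√L q}` identifies `F_{m√L}` with
`F_{(m+1)√L}`, taking `|m√L⟩` to `|(m+1)√L⟩` and commuting with `aₙ`, `n ≠ 0`. -/
def vertexCoeff (L : ℕ) (p : ℤ) : Module.End ℂ Space :=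
  Finsupp.lsum ℂ fun m : ℤ =>
    (Finsupp.lsingle (m + 1) : Fock →ₗ[ℂ] Space) ∘ₗ
      normalOrdered (Real.sqrt L : ℂ) ((m : ℂ) * (Real.sqrt L : ℂ)) (p - m * L)

/-- The modes `eₙ` of `V_{√(2N)}(z) = ∑ₙ eₙ z^{-n-N}`. -/
def e (N : ℕ) (n : ℤ) : Module.End ℂ Space := vertexCoeff (2 * N) (-n - N)

/-- The modes `θₙ` of `V_{√(2N+1)}(z) = ∑ₙ θₙ z^{-n}`. -/
def θ (N : ℕ) (n : ℤ) : Module.End ℂ Space := vertexCoeff (2 * N + 1) (-n)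

/-- The algebra of all polynomials in the operators `xᵢ`, `i ∈ S`. -/
def polyOps (x : ℤ → Module.End ℂ Space) (S : Set ℤ) : Submodule ℂ (Module.End ℂ Space) :=
  (Algebra.adjoin ℂ (x '' S)).toSubmodule

/-- `x_{j₁} x_{j₂} ⋯ x_{jₖ}` is a Fibonacci-`l` monomial: `j_m - j_{m-1} > l` for `m = 2, …, k`. -/
def IsFibonacci (l : ℤ) (w : List ℤ) : Prop := w.IsChain fun a b => b - a > l

/-- The space of Fibonacci-`l` polynomials in the operators `xᵢ`, `i ∈ S`: the linear combinations
of Fibonacci-`l` monomials. -/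
def fibOps (l : ℤ) (x : ℤ → Module.End ℂ Space) (S : Set ℤ) :
    Submodule ℂ (Module.End ℂ Space) :=
  Submodule.span ℂ {T | ∃ w : List ℤ, IsFibonacci l w ∧ (∀ i ∈ w, i ∈ S) ∧ T = (w.map x).prod}

/-- The subspace `A v` of vectors obtained by applying the operators in `A` to `v`. -/
def applyTo (A : Submodule ℂ (Module.End ℂ Space)) (v : Space) : Submodule ℂ Space :=
  A.map (LinearMap.applyₗ v)

/-- The basic subspace `W_j` of `V_{√(2N) ℤ}`. -/
def basicEven (N : ℕ) (j : ℤ) : Submodule ℂ Space :=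
  applyTo (polyOps (e N) Set.univ) (vac j)

/-- The basic subspace `W_j` of `V_{√(2N+1) ℤ}`. -/
def basicOdd (N : ℕ) (j : ℤ) : Submodule ℂ Space :=
  applyTo (polyOps (θ N) Set.univ) (vac j)

end LatticeVA

end

/-! Write `v_p` for the coefficient of `z^p` in the vertex operator; `e_n` and `θ_n` are `v_{c-n}`
with `c = -N` and `c = 0`. Everything follows from the operator product expansion `V(z) V(w) = (z -
w)^L :V(z) V(w):`, where the coefficients `G r s` of the normally ordered product, applied to a
fixed vector, are symmetric and vanish for small `r` or small `s`.

Symmetry gives commutation up to the sign `(-1)^L` (`vertexCoeff_mul_comm`). The zero of order `L`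
on the diagonal gives quadratic relations: an `L`-th finite difference kills polynomials of degree
less than `L`, so `∑ P(a) v_a v_{n-a} = 0` for each such `P` (`finsum_eval_smul_vertexCoeff`). At
most `L` integers `a` satisfy `|2a - n| < L`, so interpolation isolates any one of them and rewrites
a product of modes at distance less than `L` through products with the same index sum and distance
at least `L` (`mem_span_of_abs_sub_lt`).

Since `v_p` kills `|j√L⟩` for `p < jL` (`vertexCoeff_vac`), the rewriting terminates: it preserves
the index sum and strictly raises the sum of squares, which is bounded while all indices are at
least `jL` (`prod_map_apply_mem_span`). The surviving words are the Fibonacci monomials. This puts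
the largest of the three spaces inside the smallest; the other inclusions are formal. -/

noncomputable section

namespace LatticeVA

open Finset

/-! ### Exponentials of power series with commuting coefficients -/

section ExpSeries

variable {A : Type*} [Ring A]

/-- The coefficient of `tⁿ`, for an integer `n`, in a power series. -/
def intCoeff (g : PowerSeries A) (n : ℤ) : A :=
  if 0 ≤ n then PowerSeries.coeff n.toNat g else 0

theorem intCoeff_of_neg (g : PowerSeries A) {n : ℤ} (h : n < 0) : intCoeff g n = 0 :=
  if_neg (not_le.2 h)

@[simp]
theorem intCoeff_natCast (g : PowerSeries A) (n : ℕ) : intCoeff g n = PowerSeries.coeff n g := by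
  simp [intCoeff]

theorem coeff_pow_eq_zero {g : PowerSeries A} (h0 : PowerSeries.coeff 0 g = 0) :
    ∀ {m n : ℕ}, n < m → PowerSeries.coeff n (g ^ m) = 0 := by
  intro m
  induction m with
  | zero => intro n h; omega
  | succ m ih =>
    intro n h
    rw [pow_succ', PowerSeries.coeff_mul]
    refine sum_eq_zero fun p hp => ?_
    have := mem_antidiagonal.1 hp
    rcases Nat.eq_zero_or_pos p.1 with h1 | h1
    · rw [h1, h0, zero_mul]
    · rw [ih (by omega), mul_zero]

theorem commute_of_coeff {g h : PowerSeries A}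
    (H : ∀ i j, Commute (PowerSeries.coeff i g) (PowerSeries.coeff j h)) : Commute g h := by
  ext n
  rw [PowerSeries.coeff_mul, PowerSeries.coeff_mul, ← Nat.sum_antidiagonal_swap]
  exact sum_congr rfl fun p _ => H _ _

variable [Algebra ℂ A]

/-- The Euler operator `t d/dt` on formal power series. -/
def eulerOp (g : PowerSeries A) : PowerSeries A :=
  PowerSeries.mk fun n => (n : ℂ) • PowerSeries.coeff n g

theorem eulerOp_mul (g h : PowerSeries A) :
    eulerOp (g * h) = eulerOp g * h + g * eulerOp h := by
  ext n
  simp only [eulerOp, PowerSeries.coeff_mk, map_add, PowerSeries.coeff_mul, smul_sum,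
    ← sum_add_distrib]
  refine sum_congr rfl fun p hp => ?_
  rw [← mem_antidiagonal.1 hp, smul_mul_assoc, mul_smul_comm, ← add_smul]
  push_cast
  rfl

theorem eulerOp_pow {g : PowerSeries A} (hg : Commute g (eulerOp g)) (m : ℕ) :
    eulerOp (g ^ (m + 1)) = ((m : ℂ) + 1) • (eulerOp g * g ^ m) := by
  induction m with
  | zero => simp
  | succ m ih =>
    rw [pow_succ, eulerOp_mul, ih, smul_mul_assoc, mul_assoc, ← pow_succ,
      (hg.pow_left (m + 1)).eq]
    push_cast
    rw [add_smul ((m : ℂ) + 1) 1, one_smul]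

/-- The power `g ^ m` has order at least `m`, so a common cutoff may serve for all coefficients
below it. -/
theorem coeff_expSeries_of_le {g : PowerSeries A} (h0 : PowerSeries.coeff 0 g = 0) {n K : ℕ}
    (h : n < K) : PowerSeries.coeff n (expSeries g) =
      ∑ m ∈ range K, ((m ! : ℂ)⁻¹) • PowerSeries.coeff n (g ^ m) := by
  rw [expSeries, PowerSeries.coeff_mk]
  refine sum_subset (range_subset_range.2 h) fun m _ hm => ?_
  rw [coeff_pow_eq_zero h0 (by simpa using hm), smul_zero]

/-- The differential equation `t (exp g)' = (t g') exp g`. Comparing coefficients in it yields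
recursions in which inductions can divide by `n`. -/
theorem eulerOp_expSeries {g : PowerSeries A} (h0 : PowerSeries.coeff 0 g = 0)
    (hg : ∀ i j, Commute (PowerSeries.coeff i g) (PowerSeries.coeff j g)) :
    eulerOp (expSeries g) = eulerOp g * expSeries g := by
  have hc : Commute g (eulerOp g) := commute_of_coeff fun i j => by
    rw [eulerOp, PowerSeries.coeff_mk]; exact (hg i j).smul_right _
  ext n
  rw [PowerSeries.coeff_mul, eulerOp, PowerSeries.coeff_mk,
    coeff_expSeries_of_le h0 (show n < n + 1 + 1 by omega), sum_range_succ', smul_add, smul_sum]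
  -- The term `m = 0` is the constant series `1`, which the Euler operator kills.
  have hz : (n : ℂ) • ((((0 ! : ℕ) : ℂ)⁻¹) • PowerSeries.coeff n (g ^ 0)) = 0 := by
    rcases Nat.eq_zero_or_pos n with h | h
    · simp [h]
    · simp [PowerSeries.coeff_one, h.ne']
  rw [hz, add_zero]
  have h1 : ∀ m, (n : ℂ) • ((((m + 1) ! : ℕ) : ℂ)⁻¹ • PowerSeries.coeff n (g ^ (m + 1))) =
      ∑ p ∈ antidiagonal n, PowerSeries.coeff p.1 (eulerOp g) *
        (((m ! : ℕ) : ℂ)⁻¹ • PowerSeries.coeff p.2 (g ^ m)) := by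
    intro m
    have h2 : (n : ℂ) • PowerSeries.coeff n (g ^ (m + 1)) =
        PowerSeries.coeff n (eulerOp (g ^ (m + 1))) := by rw [eulerOp, PowerSeries.coeff_mk]
    have h3 : ∀ (c : ℂ) (f : PowerSeries A),
        PowerSeries.coeff n (c • f) = c • PowerSeries.coeff n f := fun _ _ => rfl
    rw [smul_comm, h2, eulerOp_pow hc, h3, smul_smul, PowerSeries.coeff_mul, smul_sum]
    refine sum_congr rfl fun p _ => ?_
    rw [mul_smul_comm]
    congr 1
    rw [Nat.factorial_succ]
    have : ((m : ℂ) + 1) ≠ 0 := Nat.cast_add_one_ne_zero m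
    push_cast
    field_simp
  rw [sum_congr rfl fun m _ => h1 m, sum_comm]
  refine sum_congr rfl fun p hp => ?_
  rw [← mul_sum, coeff_expSeries_of_le h0]
  have := mem_antidiagonal.1 hp
  omega

/-- Integer indices make the terms with `k ≥ n` vanish, so the cutoff `K` can be shared by sums with
different `n`. -/
theorem natCast_smul_coeff_expSeries {g : PowerSeries A} (h0 : PowerSeries.coeff 0 g = 0)
    (hg : ∀ i j, Commute (PowerSeries.coeff i g) (PowerSeries.coeff j g)) (n : ℤ) (K : ℕ)
    (hK : n ≤ K) :
    (n : ℂ) • intCoeff (expSeries g) n = ∑ k ∈ range K,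
      (((k : ℂ) + 1) • PowerSeries.coeff (k + 1) g) * intCoeff (expSeries g) (n - k - 1) := by
  rcases lt_or_ge n 0 with hn | hn
  · rw [intCoeff_of_neg _ hn, smul_zero, sum_eq_zero]
    intro k _
    rw [intCoeff_of_neg _ (by omega), mul_zero]
  · lift n to ℕ using hn
    have h := congrArg (PowerSeries.coeff n) (eulerOp_expSeries h0 hg)
    rw [eulerOp, PowerSeries.coeff_mk, PowerSeries.coeff_mul,
      Nat.sum_antidiagonal_eq_sum_range_succ_mk, sum_range_succ'] at h
    rw [intCoeff_natCast, Int.cast_natCast, h]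
    simp only [eulerOp, PowerSeries.coeff_mk, h0, smul_zero, zero_mul, add_zero]
    have hnK : n ≤ K := by exact_mod_cast hK
    rw [← sum_subset (range_subset_range.2 hnK)]
    · refine sum_congr rfl fun k hk => ?_
      have hk := mem_range.1 hk
      have : (n : ℤ) - k - 1 = ((n - (k + 1) : ℕ) : ℤ) := by omega
      rw [this, intCoeff_natCast]
      push_cast
      rfl
    · intro k _ hk
      rw [intCoeff_of_neg _ (by have := mem_range.not.1 hk; omega), mul_zero]

theorem intCoeff_expSeries_zero (g : PowerSeries A) : intCoeff (expSeries g) 0 = 1 := by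
  simp [intCoeff, expSeries]

/-- Whatever commutes with the coefficients of `g` commutes with those of `exp g`. -/
theorem commute_intCoeff_expSeries {g : PowerSeries A} {x : A}
    (hx : ∀ i, Commute x (PowerSeries.coeff i g)) (n : ℤ) :
    Commute x (intCoeff (expSeries g) n) := by
  have hp : ∀ m i, Commute x (PowerSeries.coeff i (g ^ m)) := by
    intro m
    induction m with
    | zero =>
      intro i
      rw [pow_zero, PowerSeries.coeff_one]
      split_ifs
      exacts [Commute.one_right x, Commute.zero_right x]
    | succ m ih =>
      intro i
      rw [pow_succ, PowerSeries.coeff_mul]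
      exact Commute.sum_right _ _ _ fun p _ => (ih _).mul_right (hx _)
  rw [intCoeff]
  split_ifs
  · rw [expSeries, PowerSeries.coeff_mk]
    exact Commute.sum_right _ _ _ fun m _ => (hp m _).smul_right _
  · exact Commute.zero_right x

theorem commute_intCoeff_expSeries_self {g : PowerSeries A}
    (hg : ∀ i j, Commute (PowerSeries.coeff i g) (PowerSeries.coeff j g)) (m n : ℤ) :
    Commute (intCoeff (expSeries g) m) (intCoeff (expSeries g) n) :=
  commute_intCoeff_expSeries (fun i =>
    (commute_intCoeff_expSeries (fun j => hg i j) m).symm) n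

end ExpSeries

/-! ### Creation and annihilation modes and their exchange relation -/

section Modes

/-- Only `a₀` depends on the highest weight `ν`, and it does not occur in the exponent. -/
theorem creationExp_eq (μ ν : ℂ) : creationExp μ ν = creationExp μ 0 := by
  unfold creationExp
  congr 1
  ext1 k
  rw [PowerSeries.coeff_mk, PowerSeries.coeff_mk]
  rcases k with _ | k <;> rfl

theorem annihilationExp_eq (μ ν : ℂ) : annihilationExp μ ν = annihilationExp μ 0 := by
  unfold annihilationExp
  congr 1
  ext1 k
  rw [PowerSeries.coeff_mk, PowerSeries.coeff_mk]
  rcases k with _ | k <;> rfl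

/-- The coefficient of `zⁿ` in the creation part of the vertex operator. -/
def creationMode (μ : ℂ) (n : ℤ) : Module.End ℂ Fock := intCoeff (creationExp μ 0) n

/-- The coefficient of `z⁻ⁿ` in the annihilation part of the vertex operator. -/
def annihilationMode (μ : ℂ) (n : ℤ) : Module.End ℂ Fock := intCoeff (annihilationExp μ 0) n

variable (μ : ℂ)

theorem creationMode_of_neg {n : ℤ} (h : n < 0) : creationMode μ n = 0 := intCoeff_of_neg _ h

theorem annihilationMode_of_neg {n : ℤ} (h : n < 0) : annihilationMode μ n = 0 :=
  intCoeff_of_neg _ h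

theorem creationMode_zero : creationMode μ 0 = 1 := intCoeff_expSeries_zero _

theorem annihilationMode_zero : annihilationMode μ 0 = 1 := intCoeff_expSeries_zero _

/-- Multiplication by the variable `Xₖ`. -/
def mulX (k : ℕ) : Module.End ℂ Fock := LinearMap.mulLeft ℂ (MvPolynomial.X k)

/-- The partial derivative with respect to `Xₖ`. -/
def partialX (k : ℕ) : Module.End ℂ Fock := (MvPolynomial.pderiv k).toLinearMap

theorem commute_mulX (i j : ℕ) : Commute (mulX i) (mulX j) := by
  ext1
  ext f
  simp [mulX, mul_left_comm]

theorem commute_partialX (i j : ℕ) : Commute (partialX i) (partialX j) := by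
  have h : ⁅MvPolynomial.pderiv (R := ℂ) i, MvPolynomial.pderiv (R := ℂ) j⁆ = 0 := by
    ext k
    simp [Derivation.commutator_apply, MvPolynomial.pderiv_X, Pi.single_apply, apply_ite]
  refine LinearMap.ext fun f => ?_
  have := DFunLike.congr_fun h f
  rw [Derivation.commutator_apply, Derivation.zero_apply, sub_eq_zero] at this
  exact this

theorem partialX_mul_mulX (i j : ℕ) :
    partialX i * mulX j = mulX j * partialX i + if i = j then 1 else 0 := by
  refine LinearMap.ext fun f => ?_
  split_ifs with h
  · subst h
    simp [partialX, mulX]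
  · simp [partialX, mulX, MvPolynomial.pderiv_X_of_ne (Ne.symm h)]

theorem creationMode_commute (m n : ℤ) : Commute (creationMode μ m) (creationMode μ n) := by
  refine commute_intCoeff_expSeries_self (fun i j => ?_) m n
  rw [PowerSeries.coeff_mk, PowerSeries.coeff_mk]
  rcases i with _ | i
  · simp
  rcases j with _ | j
  · simp
  rw [if_neg (Nat.succ_ne_zero i), if_neg (Nat.succ_ne_zero j)]
  exact ((commute_mulX i j).smul_left _).smul_right _

theorem annihilationMode_commute (m n : ℤ) :
    Commute (annihilationMode μ m) (annihilationMode μ n) := by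
  refine commute_intCoeff_expSeries_self (fun i j => ?_) m n
  rw [PowerSeries.coeff_mk, PowerSeries.coeff_mk]
  rcases i with _ | i
  · simp
  rcases j with _ | j
  · simp
  rw [if_neg (Nat.succ_ne_zero i), if_neg (Nat.succ_ne_zero j)]
  exact ((((commute_partialX i j).smul_left _).smul_right _).smul_left _).smul_right _

theorem creationMode_rec (n : ℤ) (K : ℕ) (hK : n ≤ K) :
    (n : ℂ) • creationMode μ n =
      ∑ k ∈ range K, (μ • mulX k) * creationMode μ (n - k - 1) := by
  refine (natCast_smul_coeff_expSeries (by simp) (fun i j => ?_) n K hK).trans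
    (sum_congr rfl fun k _ => ?_)
  · rw [PowerSeries.coeff_mk, PowerSeries.coeff_mk]
    rcases i with _ | i
    · simp
    rcases j with _ | j
    · simp
    rw [if_neg (Nat.succ_ne_zero i), if_neg (Nat.succ_ne_zero j)]
    exact ((commute_mulX i j).smul_left _).smul_right _
  · congr 1
    rw [PowerSeries.coeff_mk, if_neg (Nat.succ_ne_zero k), smul_smul]
    have : ((k : ℂ) + 1) ≠ 0 := Nat.cast_add_one_ne_zero k
    congr 1
    push_cast
    field_simp

theorem annihilationMode_rec (n : ℤ) (K : ℕ) (hK : n ≤ K) :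
    (n : ℂ) • annihilationMode μ n =
      ∑ k ∈ range K, ((-μ * (k + 1)) • partialX k) * annihilationMode μ (n - k - 1) := by
  refine (natCast_smul_coeff_expSeries (by simp) (fun i j => ?_) n K hK).trans
    (sum_congr rfl fun k _ => ?_)
  · rw [PowerSeries.coeff_mk, PowerSeries.coeff_mk]
    rcases i with _ | i
    · simp
    rcases j with _ | j
    · simp
    rw [if_neg (Nat.succ_ne_zero i), if_neg (Nat.succ_ne_zero j)]
    exact ((((commute_partialX i j).smul_left _).smul_right _).smul_left _).smul_right _
  · congr 1
    have h : heis 0 ((k + 1 : ℕ) : ℤ) = ((k : ℂ) + 1) • partialX k := rfl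
    rw [PowerSeries.coeff_mk, if_neg (Nat.succ_ne_zero k), h, smul_smul, smul_smul]
    have : ((k : ℂ) + 1) ≠ 0 := Nat.cast_add_one_ne_zero k
    congr 1
    push_cast
    field_simp

/-- Differentiating `exp (μ ∑ X_k z^{k+1} / (k+1))` in `X_j` multiplies it by `μ z^{j+1} / (j+1)`.
In coefficients this is an induction on `n` through `creationMode_rec`. -/
theorem partialX_mul_creationMode (j : ℕ) (n : ℤ) :
    partialX j * creationMode μ n =
      creationMode μ n * partialX j + (μ / (j + 1)) • creationMode μ (n - j - 1) := by
  suffices h : ∀ (N : ℕ) (n : ℤ), n < N → partialX j * creationMode μ n =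
      creationMode μ n * partialX j + (μ / (j + 1)) • creationMode μ (n - j - 1) from
    h (n.toNat + 1) n (by omega)
  intro N
  induction N with
  | zero =>
    intro n hn
    rw [creationMode_of_neg μ (by omega : n < 0), creationMode_of_neg μ (by omega)]
    simp
  | succ N ih =>
    intro n hn
    rcases lt_trichotomy n 0 with h | h | h
    · rw [creationMode_of_neg μ h, creationMode_of_neg μ (by omega)]
      simp
    · subst h
      rw [creationMode_zero, creationMode_of_neg μ (by omega)]
      simp
    · have hn0 : (n : ℂ) ≠ 0 := by exact_mod_cast h.ne'
      have hj : ((j : ℂ) + 1) ≠ 0 := Nat.cast_add_one_ne_zero j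
      -- The cutoff exceeds `j` as well, so that the term `k = j` of the commutator is in range.
      have hK : n ≤ ((n.toNat + j + 1 : ℕ) : ℤ) := by omega
      apply smul_right_injective _ hn0
      simp only
      rw [← mul_smul_comm, smul_add, ← smul_mul_assoc, creationMode_rec μ n _ hK, mul_sum, sum_mul]
      have h1 : ∀ k ∈ range (n.toNat + j + 1),
          partialX j * ((μ • mulX k) * creationMode μ (n - k - 1)) =
            (μ • mulX k) * creationMode μ (n - k - 1) * partialX j +
            (μ / (j + 1)) • ((μ • mulX k) * creationMode μ (n - j - 1 - k - 1)) +
            if j = k then μ • creationMode μ (n - k - 1) else 0 := by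
        intro k _
        have e1 : n - k - 1 - j - 1 = n - j - 1 - k - 1 := by ring
        rw [← mul_assoc, mul_smul_comm, partialX_mul_mulX, smul_add, add_mul, smul_mul_assoc,
          mul_assoc, ih (n - k - 1) (by omega), e1]
        split_ifs <;> simp [mul_add, mul_assoc, smul_comm μ]
      rw [sum_congr rfl h1, sum_add_distrib, sum_add_distrib, ← smul_sum,
        ← creationMode_rec μ (n - j - 1) _ (by omega), sum_ite_eq, if_pos (by simp),
        add_assoc]
      congr 1
      -- The coefficients add up as `(n - j - 1) μ / (j + 1) + μ = n μ / (j + 1)`.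
      rw [smul_smul, smul_smul, ← add_smul]
      congr 1
      push_cast
      field_simp
      ring

/-- Coefficient form of `t f' = -L t (1 - t)⁻¹ f` for `f = (1 - t)^L`. -/
theorem mul_alternating_choose (L m : ℕ) :
    (m : ℂ) * ((-1) ^ m * L.choose m) =
      -(L : ℂ) * ∑ i ∈ range m, (-1) ^ i * (L.choose i : ℂ) := by
  rcases m with _ | m
  · simp
  rcases L with _ | L
  · simp
  have h := Int.alternating_sum_range_choose_eq_choose (n := L) (m := m)
  have h2 : (∑ i ∈ range (m + 1), (-1) ^ i * ((L + 1).choose i : ℂ)) =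
      (-1) ^ m * (L.choose m : ℂ) := by exact_mod_cast congrArg (Int.cast : ℤ → ℂ) h
  have h3 : ((L : ℂ) + 1) * L.choose m = (L + 1).choose (m + 1) * ((m : ℂ) + 1) := by
    exact_mod_cast Nat.add_one_mul_choose_eq L m
  rw [h2]
  push_cast
  linear_combination (-1 : ℂ) ^ m * h3

theorem sum_range_sum_range_smul_shift {M : Type*} [AddCommGroup M] [Module ℂ M] (K : ℕ)
    (a : ℕ → ℂ) (F : ℕ → M) (hF : ∀ m, K ≤ m → F m = 0) :
    ∑ k ∈ range K, ∑ i ∈ range K, a i • F (i + k + 1) =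
      ∑ m ∈ range K, (∑ i ∈ range m, a i) • F m := by
  have h1 : ∀ i ∈ range K, ∑ k ∈ range K, a i • F (i + k + 1) =
      ∑ m ∈ Ico (i + 1) K, a i • F m := by
    intro i _
    rw [sum_Ico_eq_sum_range]
    refine (sum_subset (range_subset_range.2 (by omega)) fun k _ hk => ?_).symm.trans
      (sum_congr rfl fun k _ => by rw [add_right_comm])
    rw [hF _ (by have := mem_range.not.1 hk; omega), smul_zero]
  rw [sum_comm, sum_congr rfl h1]
  simp_rw [sum_smul]
  refine sum_comm' fun i m => ?_
  simp only [mem_range, mem_Ico]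
  omega

/-- Moving the annihilation exponential in `z` past the creation exponential in `w` produces the
factor `(1 - w/z)^L`. Both sides satisfy the same recursion in `n`: the commutator terms from
`partialX_mul_creationMode` match the Euler equation of `(1 - t)^L`. The cutoff `K` replaces `L + 1`
to agree with that of the recursion. -/
theorem annihilationMode_mul_creationMode_aux {L : ℕ} (hμ : μ * μ = L) (s : ℤ) (K : ℕ) (n : ℤ)
    (hn : n < K) : annihilationMode μ n * creationMode μ s =
      ∑ i ∈ range K, ((-1) ^ i * (L.choose i : ℂ)) •
        (creationMode μ (s - i) * annihilationMode μ (n - i)) := by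
  suffices h : ∀ (N : ℕ) (n : ℤ), n < N → n < K → annihilationMode μ n * creationMode μ s =
      ∑ i ∈ range K, ((-1) ^ i * (L.choose i : ℂ)) •
        (creationMode μ (s - i) * annihilationMode μ (n - i)) from
    h (n.toNat + 1) n (by omega) hn
  intro N
  induction N with
  | zero =>
    intro n hn _
    rw [annihilationMode_of_neg μ (by omega : n < 0), zero_mul, sum_eq_zero]
    intro i _
    rw [annihilationMode_of_neg μ (by omega : n - i < 0), mul_zero, smul_zero]
  | succ N ih =>
    intro n hn hnK
    rcases lt_trichotomy n 0 with h | h | h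
    · rw [annihilationMode_of_neg μ h, zero_mul, sum_eq_zero]
      intro i _
      rw [annihilationMode_of_neg μ (by omega : n - i < 0), mul_zero, smul_zero]
    · subst h
      rw [annihilationMode_zero, one_mul, sum_eq_single 0]
      · simp [annihilationMode_zero]
      · intro i _ hi
        rw [annihilationMode_of_neg μ (by omega), mul_zero, smul_zero]
      · intro h0
        simp at h0
        omega
    · have hn0 : (n : ℂ) ≠ 0 := by exact_mod_cast h.ne'
      apply smul_right_injective _ hn0
      simp only
      rw [← smul_mul_assoc, annihilationMode_rec μ n K hnK.le, sum_mul]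
      have h1 : ∀ k ∈ range K, (-μ * (k + 1)) • partialX k * annihilationMode μ (n - k - 1) *
          creationMode μ s = ∑ i ∈ range K, (((-1) ^ i * (L.choose i : ℂ)) •
            (creationMode μ (s - i) * ((-μ * (k + 1)) • partialX k *
              annihilationMode μ (n - i - k - 1))) +
            (-(L : ℂ) * ((-1) ^ i * (L.choose i : ℂ))) •
              (creationMode μ (s - (i + k + 1 : ℕ)) *
                annihilationMode μ (n - (i + k + 1 : ℕ)))) := by
        intro k _
        rw [mul_assoc, ih (n - k - 1) (by omega) (by omega), mul_sum]
        refine sum_congr rfl fun i _ => ?_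
        have hk : ((k : ℂ) + 1) ≠ 0 := Nat.cast_add_one_ne_zero k
        have e1 : n - k - 1 - i = n - i - k - 1 := by ring
        have e2 : n - (i + k + 1 : ℕ) = n - i - k - 1 := by push_cast; ring
        have e3 : s - (i + k + 1 : ℕ) = s - i - k - 1 := by push_cast; ring
        rw [e1, e2, e3, mul_smul_comm, smul_mul_assoc, ← mul_assoc, partialX_mul_creationMode,
          add_mul, smul_mul_assoc, smul_mul_assoc, mul_smul_comm, smul_add, smul_add, smul_smul,
          smul_smul, smul_smul, smul_smul, mul_assoc]
        congr 2
        rw [← hμ]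
        field_simp
      rw [sum_congr rfl h1]
      simp_rw [sum_add_distrib]
      rw [sum_range_sum_range_smul_shift K (fun i => -(L : ℂ) * ((-1) ^ i * (L.choose i : ℂ)))
        (fun m => creationMode μ (s - m) * annihilationMode μ (n - m))
        (fun m hm => by rw [annihilationMode_of_neg μ (by omega), mul_zero]), sum_comm,
        ← sum_add_distrib, smul_sum]
      refine sum_congr rfl fun i _ => ?_
      rw [← smul_sum, ← mul_sum, ← annihilationMode_rec μ (n - i) K (by omega), ← mul_sum,
        ← mul_alternating_choose, mul_smul_comm, smul_smul, smul_smul, ← add_smul]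
      congr 1
      push_cast
      ring

theorem annihilationMode_mul_creationMode {L : ℕ} (hμ : μ * μ = L) (n s : ℤ) :
    annihilationMode μ n * creationMode μ s =
      ∑ i ∈ range (L + 1), ((-1) ^ i * (L.choose i : ℂ)) •
        (creationMode μ (s - i) * annihilationMode μ (n - i)) := by
  rw [annihilationMode_mul_creationMode_aux μ hμ s (n.toNat + 1 + (L + 1)) n (by omega)]
  refine (sum_subset (range_subset_range.2 (by omega)) fun i _ hi => ?_).symm
  rw [Nat.choose_eq_zero_of_lt (by have := mem_range.not.1 hi; omega), Nat.cast_zero, mul_zero,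
    zero_smul]

end Modes

/-! ### Operator product expansion of two vertex operators -/

section VertexOperator

variable (μ : ℂ)

theorem exists_annihilationMode_eq_zero (f : Fock) :
    ∃ K : ℕ, ∀ k : ℤ, K ≤ k → annihilationMode μ k f = 0 := by
  obtain ⟨K, hK⟩ := (annihilationExp_finite μ 0 f).bddAbove
  refine ⟨K + 1, fun k hk => ?_⟩
  lift k to ℕ using by omega
  by_contra h
  have := hK (a := k) (by simpa [annihilationMode] using h)
  omega

theorem normalOrdered_eq_sum {f : Fock} {K : ℕ}
    (hK : ∀ k : ℤ, K ≤ k → annihilationMode μ k f = 0) (ν : ℂ) (r : ℤ) :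
    normalOrdered μ ν r f =
      ∑ k ∈ range K, creationMode μ (r + k) (annihilationMode μ k f) := by
  have h : normalOrdered μ ν r f =
      ∑ᶠ k : ℕ, creationMode μ (r + k) (annihilationMode μ k f) := by
    change ∑ᶠ k : ℕ, zcoeff (creationExp μ ν) (r + k)
      (PowerSeries.coeff k (annihilationExp μ ν) f) = _
    rw [creationExp_eq, annihilationExp_eq]
    simp only [annihilationMode, intCoeff_natCast]
    rfl
  rw [h]
  refine finsum_eq_sum_of_support_subset _ fun k hk => ?_
  by_contra hk'
  refine hk ?_
  simp only
  rw [hK k (by simpa using hk'), map_zero]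

/-- The coefficient of `zʳ wˢ` in the normally ordered product of two vertex operators, without
the zero modes, provided that the annihilation modes with index at least `K` kill `f`. -/
def normalOrderedPair (K : ℕ) (f : Fock) (r s : ℤ) : Fock :=
  ∑ k ∈ range K, ∑ j ∈ range K, creationMode μ (r + j)
    (creationMode μ (s + k) (annihilationMode μ j (annihilationMode μ k f)))

theorem normalOrderedPair_comm (K : ℕ) (f : Fock) (r s : ℤ) :
    normalOrderedPair μ K f r s = normalOrderedPair μ K f s r := by
  rw [normalOrderedPair, normalOrderedPair, sum_comm]
  refine sum_congr rfl fun j _ => sum_congr rfl fun k _ => ?_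
  have h1 := LinearMap.congr_fun (creationMode_commute μ (r + j) (s + k)).eq
  have h2 := LinearMap.congr_fun (annihilationMode_commute μ j k).eq f
  simp only [Module.End.mul_apply] at h1 h2
  rw [h1, h2]

theorem normalOrderedPair_eq_zero (K : ℕ) (f : Fock) {r : ℤ} (s : ℤ) (hr : r < -K) :
    normalOrderedPair μ K f r s = 0 := by
  refine sum_eq_zero fun k _ => sum_eq_zero fun j hj => ?_
  have := mem_range.1 hj
  rw [creationMode_of_neg μ (by omega), LinearMap.zero_apply]

theorem normalOrdered_normalOrdered {L : ℕ} (hμ : μ * μ = L) {f : Fock} {K : ℕ}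
    (hK : ∀ k : ℤ, K ≤ k → annihilationMode μ k f = 0) (ν ν' : ℂ) (r s : ℤ) :
    normalOrdered μ ν r (normalOrdered μ ν' s f) =
      ∑ i ∈ range (L + 1), ((-1) ^ i * (L.choose i : ℂ)) •
        normalOrderedPair μ K f (r + i) (s - i) := by
  have hK2 : ∀ (l : ℤ) (k : ℤ), K ≤ l →
      annihilationMode μ l (annihilationMode μ k f) = 0 := by
    intro l k hl
    have h2 := LinearMap.congr_fun (annihilationMode_commute μ l k).eq f
    simp only [Module.End.mul_apply] at h2
    rw [h2, hK l hl, map_zero]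
  have hA : ∀ l k : ℤ, annihilationMode μ l (creationMode μ (s + k) (annihilationMode μ k f)) =
      ∑ i ∈ range (L + 1), ((-1) ^ i * (L.choose i : ℂ)) • creationMode μ (s + k - i)
        (annihilationMode μ (l - i) (annihilationMode μ k f)) := by
    intro l k
    have := LinearMap.congr_fun (annihilationMode_mul_creationMode μ hμ l (s + k))
      (annihilationMode μ k f)
    simpa [LinearMap.sum_apply] using this
  have hB : ∀ k : ℕ, normalOrdered μ ν r (creationMode μ (s + k) (annihilationMode μ k f)) =
      ∑ i ∈ range (L + 1), ((-1) ^ i * (L.choose i : ℂ)) • ∑ j ∈ range K,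
        creationMode μ (r + i + j) (creationMode μ (s - i + k)
          (annihilationMode μ j (annihilationMode μ k f))) := by
    intro k
    -- The exchange lowers annihilation indices by at most `L`, so from `L + K` on they still kill
    -- the vector.
    rw [normalOrdered_eq_sum μ (K := L + K)]
    · simp_rw [hA, map_sum, map_smul]
      rw [sum_comm]
      refine sum_congr rfl fun i hi => ?_
      have hi := mem_range.1 hi
      rw [← smul_sum]
      congr 1
      have hs : Ico i (i + K) ⊆ range (L + K) := fun l hl => by
        rw [mem_Ico] at hl
        rw [mem_range]
        omega
      rw [← sum_subset hs, sum_Ico_eq_sum_range]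
      · refine sum_congr (by simp) fun j _ => ?_
        have e1 : ((i + j : ℕ) : ℤ) - i = j := by push_cast; ring
        have e2 : r + (i + j : ℕ) = r + i + j := by push_cast; ring
        have e3 : s + k - i = s - i + k := by ring
        rw [e1, e2, e3]
      · intro l _ hl
        rw [mem_Ico, not_and_or] at hl
        rcases hl with hl | hl
        · rw [annihilationMode_of_neg μ (by omega)]
          simp
        · rw [hK2 _ _ (by omega)]
          simp
    · intro l hl
      rw [hA]
      refine sum_eq_zero fun i hi => ?_
      have := mem_range.1 hi
      rw [hK2 _ _ (by push_cast at hl; omega), map_zero, smul_zero]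
  rw [normalOrdered_eq_sum μ hK ν' s, map_sum, sum_congr rfl fun k _ => hB k, sum_comm]
  refine sum_congr rfl fun i _ => ?_
  rw [← smul_sum]
  rfl

theorem vertexCoeff_single (L : ℕ) (p m : ℤ) (f : Fock) :
    vertexCoeff L p (Finsupp.single m f) = Finsupp.single (m + 1)
      (normalOrdered (Real.sqrt L : ℂ) ((m : ℂ) * (Real.sqrt L : ℂ)) (p - m * L) f) := by
  simp [vertexCoeff]

theorem sqrt_mul_sqrt_complex (L : ℕ) : (Real.sqrt L : ℂ) * (Real.sqrt L : ℂ) = L := by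
  rw [← Complex.ofReal_mul, Real.mul_self_sqrt (Nat.cast_nonneg L), Complex.ofReal_natCast]

/-- The operator product expansion `V(z) V(w) = (z - w)ᴸ :V(z) V(w):` in coefficients. -/
theorem exists_vertexCoeff_vertexCoeff (L : ℕ) (x : Space) :
    ∃ G : ℤ → ℤ → Space, (∀ r s, G r s = G s r) ∧ (∃ M : ℤ, ∀ r s, r < M → G r s = 0) ∧
      ∀ p q, vertexCoeff L p (vertexCoeff L q x) =
        ∑ i ∈ range (L + 1), ((-1) ^ i * (L.choose i : ℂ)) • G (p - L + i) (q - i) := by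
  induction x using Finsupp.induction_linear with
  | zero => exact ⟨0, fun _ _ => rfl, ⟨0, fun _ _ _ => rfl⟩, fun p q => by simp⟩
  | add x y hx hy =>
    obtain ⟨G, hG, ⟨M, hM⟩, h⟩ := hx
    obtain ⟨G', hG', ⟨M', hM'⟩, h'⟩ := hy
    refine ⟨G + G', fun r s => ?_, ⟨min M M', fun r s hr => ?_⟩, fun p q => ?_⟩
    · simp only [Pi.add_apply]
      rw [hG, hG']
    · simp only [Pi.add_apply]
      rw [hM r s (lt_of_lt_of_le hr (min_le_left _ _)),
        hM' r s (lt_of_lt_of_le hr (min_le_right _ _)), add_zero]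
    · rw [map_add, map_add, h, h', ← sum_add_distrib]
      simp
  | single m f =>
    obtain ⟨K, hK⟩ := exists_annihilationMode_eq_zero (Real.sqrt L : ℂ) f
    refine ⟨fun r s => Finsupp.single (m + 1 + 1)
      (normalOrderedPair (Real.sqrt L : ℂ) K f (r - m * L) (s - m * L)), fun r s => ?_,
      ⟨-K + m * L, fun r s hr => ?_⟩, fun p q => ?_⟩
    · simp only
      rw [normalOrderedPair_comm]
    · simp only
      rw [normalOrderedPair_eq_zero _ _ _ _ (by linarith), Finsupp.single_zero]
    · rw [vertexCoeff_single, vertexCoeff_single,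
        normalOrdered_normalOrdered _ (sqrt_mul_sqrt_complex L) hK, Finsupp.single_finsetSum]
      refine sum_congr rfl fun i _ => ?_
      -- The left operator acts on `F_{(m+1)√L}`; its extra factor `z^L` turns `(1 - w/z)^L` into
      -- `(z - w)^L`.
      have e1 : p - (m + 1) * L + i = p - L + i - m * L := by ring
      have e2 : q - m * L - i = q - i - m * L := by ring
      rw [e1, e2, Finsupp.smul_single]

/-- The zero mode gives `z^{jL}`, annihilation modes of positive index kill the vacuum, and the
creation part has only nonnegative powers of `z`. -/
theorem vertexCoeff_vac (L : ℕ) {p j : ℤ} (hp : p < j * L) : vertexCoeff L p (vac j) = 0 := by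
  have h : ∀ k : ℤ, (1 : ℕ) ≤ k → annihilationMode (Real.sqrt L : ℂ) k (1 : Fock) = 0 := by
    intro k hk
    lift k to ℕ using by omega
    rw [annihilationMode, intCoeff_natCast]
    exact (lowers_annihilationExp _ _ k 0 1 (MvPolynomial.isWeightedHomogeneous_one _ _)).2
      (by omega)
  rw [vac, vertexCoeff_single, normalOrdered_eq_sum _ h, sum_range_one,
    creationMode_of_neg _ (by push_cast; linarith)]
  simp

end VertexOperator

/-! ### Commutation and quadratic relations between the modes -/

section Relations

/-- Reflecting `i ↦ L - i` exchanges the arguments of the symmetric `G`; the sign is that of `(z -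
w)^L` against `(w - z)^L`. -/
theorem vertexCoeff_mul_comm (L : ℕ) (p q : ℤ) :
    vertexCoeff L p * vertexCoeff L q = ((-1 : ℂ) ^ L) • (vertexCoeff L q * vertexCoeff L p) := by
  refine LinearMap.ext fun x => ?_
  obtain ⟨G, hG, -, h⟩ := exists_vertexCoeff_vertexCoeff L x
  rw [LinearMap.smul_apply, Module.End.mul_apply, Module.End.mul_apply, h, h, smul_sum,
    ← sum_range_reflect]
  refine sum_congr rfl fun i hi => ?_
  have hi : i ≤ L := Nat.lt_succ_iff.1 (mem_range.1 hi)
  have e1 : p - L + (L + 1 - 1 - i : ℕ) = p - i := by omega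
  have e2 : q - (L + 1 - 1 - i : ℕ) = q - L + i := by omega
  rw [e1, e2, hG, smul_smul, Nat.add_sub_cancel, Nat.choose_symm hi]
  congr 1
  obtain ⟨k, rfl⟩ := Nat.exists_eq_add_of_le hi
  rw [Nat.add_sub_cancel_left, pow_add]
  have h1 : ((-1 : ℂ) ^ i) * (-1) ^ i = 1 := by rw [← mul_pow]; simp
  linear_combination -((-1 : ℂ) ^ k * ((i + k).choose i : ℂ)) * h1

theorem finite_support_vertexCoeff (L : ℕ) (n : ℤ) (x : Space) :
    (Function.support fun a : ℤ => vertexCoeff L a (vertexCoeff L (n - a) x)).Finite := by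
  obtain ⟨G, hG, ⟨M, hM⟩, h⟩ := exists_vertexCoeff_vertexCoeff L x
  refine (Set.finite_Icc M (n - M + L)).subset fun a ha => ?_
  by_contra hn
  refine ha ?_
  simp only
  rw [h]
  refine sum_eq_zero fun i hi => ?_
  have := mem_range.1 hi
  rw [Set.mem_Icc, not_and_or] at hn
  rcases hn with hn | hn
  · rw [hM _ _ (by omega), smul_zero]
  · rw [hG, hM _ _ (by omega), smul_zero]

theorem sum_alternating_choose_mul_eval {L : ℕ} {P : Polynomial ℂ} (hP : P.natDegree < L)
    (y : ℂ) : ∑ i ∈ range (L + 1), ((-1) ^ i * (L.choose i : ℂ)) * P.eval (y + L - i) = 0 := by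
  have h := congrFun (Polynomial.fwdDiff_iter_eq_zero_of_degree_lt hP) y
  rw [fwdDiff_iter_eq_sum_shift, ← sum_range_reflect] at h
  rw [Pi.zero_apply] at h
  rw [← h]
  refine sum_congr rfl fun i hi => ?_
  have hi : i ≤ L := Nat.lt_succ_iff.1 (mem_range.1 hi)
  rw [Nat.add_sub_cancel, Nat.sub_sub_self hi, Nat.choose_symm hi, zsmul_eq_mul, nsmul_eq_mul,
    Nat.cast_sub hi]
  push_cast
  ring_nf

/-- After the substitution `b = a - L + i`, the coefficient of `G b (n - L - b)` is the `L`-th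
finite difference of `P` at `b`. -/
theorem finsum_eval_smul_vertexCoeff {L : ℕ} {P : Polynomial ℂ} (hP : P.natDegree < L) (n : ℤ)
    (x : Space) :
    ∑ᶠ a : ℤ, P.eval (a : ℂ) • vertexCoeff L a (vertexCoeff L (n - a) x) = 0 := by
  obtain ⟨G, hG, ⟨M, hM⟩, h⟩ := exists_vertexCoeff_vertexCoeff L x
  have hfin : ∀ (c : ℤ → ℂ), (Function.support fun a : ℤ => c a • G a (n - L - a)).Finite := by
    refine fun c => (Set.finite_Icc M (n - L - M)).subset fun a ha => ?_
    by_contra hn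
    refine ha ?_
    simp only
    rw [Set.mem_Icc, not_and_or] at hn
    rcases hn with hn | hn
    · rw [hM _ _ (by omega), smul_zero]
    · rw [hG, hM _ _ (by omega), smul_zero]
  obtain ⟨F, hF⟩ : ∃ F : ℕ → ℤ → Space, ∀ i b, F i b =
      (((-1) ^ i * (L.choose i : ℂ)) * P.eval ((b : ℂ) + L - i)) • G b (n - L - b) :=
    ⟨_, fun _ _ => rfl⟩
  have hFfin : ∀ i, (Function.support (F i)).Finite := fun i => by
    rw [show F i = _ from funext (hF i)]
    exact hfin _
  have hshift : ∀ (i : ℕ) (a : ℤ),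
      P.eval (a : ℂ) • ((-1) ^ i * (L.choose i : ℂ)) • G (a - L + i) (n - a - i) =
        F i (a + (i - L)) := by
    intro i a
    have e1 : a + (i - L : ℤ) = a - L + i := by ring
    have e2 : n - L - (a - L + i) = n - a - i := by ring
    have e3 : ((a - L + i : ℤ) : ℂ) + L - i = a := by push_cast; ring
    rw [hF, e1, e2, e3, smul_smul, mul_comm]
  have hsum : ∀ i : ℕ, ∑ᶠ a : ℤ, F i (a + (i - L)) = ∑ᶠ b : ℤ, F i b := fun i =>
    finsum_comp_equiv (Equiv.addRight (i - L : ℤ)) (f := F i)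
  simp_rw [h, smul_sum, hshift]
  rw [finsum_sum_comm, sum_congr rfl fun i _ => hsum i, ← finsum_sum_comm]
  · refine (finsum_congr fun b => ?_).trans finsum_zero
    simp_rw [hF]
    rw [← sum_smul, sum_alternating_choose_mul_eval hP, zero_smul]
  · exact fun i _ => hFfin i
  · exact fun i _ => (hFfin i).preimage (f := fun a : ℤ => a + (i - L))
      (add_left_injective _).injOn

end Relations

/-! ### Straightening words into Fibonacci form -/

section Spanning

variable {M : Type*} [AddCommGroup M] [Module ℂ M] {L : ℕ} {v : ℤ → Module.End ℂ M}

theorem exists_polynomial_eval_ne_zero {n a : ℤ} (ha : |2 * a - n| < L) :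
    ∃ P : Polynomial ℂ, P.natDegree < L ∧ P.eval (a : ℂ) ≠ 0 ∧
      ∀ c : ℤ, c ≠ a → |2 * c - n| < L → P.eval (c : ℂ) = 0 := by
  -- The integers in the open interval from `(n - L) / 2` to `(n + L) / 2`, of length `L`: at most
  -- `L` of them. Omitting `a` leaves at most `L - 1` roots.
  set T : Finset ℤ := Icc ((n - L) / 2 + 1) ((n + L - 1) / 2) with hT
  have hmem : ∀ c : ℤ, |2 * c - n| < L → c ∈ T := by
    intro c hc
    rw [abs_lt] at hc
    rw [hT, mem_Icc]
    omega
  have hcard : T.card ≤ L := by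
    rw [hT, Int.card_Icc]
    omega
  refine ⟨∏ c ∈ T.erase a, (Polynomial.X - Polynomial.C (c : ℂ)), ?_, ?_, ?_⟩
  · rw [Polynomial.natDegree_finsetProd_X_sub_C_eq_card, card_erase_of_mem (hmem a ha)]
    have := card_pos.2 ⟨a, hmem a ha⟩
    omega
  · rw [Polynomial.eval_prod, prod_ne_zero_iff]
    intro c hc
    have := (mem_erase.1 hc).1
    simp only [Polynomial.eval_sub, Polynomial.eval_X, Polynomial.eval_C, ne_eq, sub_eq_zero]
    exact_mod_cast this.symm
  · intro c hca hc
    rw [Polynomial.eval_prod]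
    exact prod_eq_zero (mem_erase.2 ⟨hca, hmem c hc⟩) (by simp)

theorem mem_span_of_abs_sub_lt
    (hfin : ∀ n x, (Function.support fun a : ℤ => v a (v (n - a) x)).Finite)
    (hrel : ∀ (P : Polynomial ℂ), P.natDegree < L → ∀ n x,
      ∑ᶠ a : ℤ, P.eval (a : ℂ) • v a (v (n - a) x) = 0)
    {a b : ℤ} (hab : |a - b| < L) (x : M) :
    v a (v b x) ∈ Submodule.span ℂ
      {y | ∃ c d : ℤ, c + d = a + b ∧ (L : ℤ) ≤ |c - d| ∧ y = v c (v d x)} := by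
  obtain ⟨P, hP, hPa, hPc⟩ := exists_polynomial_eval_ne_zero (L := L) (n := a + b) (a := a)
    (by rwa [show 2 * a - (a + b) = a - b by ring])
  have h := hrel P hP (a + b) x
  -- Inserting `a` lets its term be split off even when that term is zero.
  rw [finsum_eq_sum_of_support_subset (s := insert a (hfin (a + b) x).toFinset),
    ← add_sum_erase _ _ (mem_insert_self _ _), add_sub_cancel_left] at h
  · rw [← Submodule.smul_mem_iff _ hPa, eq_neg_of_add_eq_zero_left h]
    refine neg_mem (sum_mem fun c hc => ?_)
    by_cases hcL : |2 * c - (a + b)| < L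
    · rw [hPc c (mem_erase.1 hc).1 hcL, zero_smul]
      exact zero_mem _
    · refine Submodule.smul_mem _ _ (Submodule.subset_span ⟨c, a + b - c, by ring, ?_, rfl⟩)
      rw [show c - (a + b - c) = 2 * c - (a + b) by ring]
      exact not_lt.1 hcL
  · intro c hc
    simp only [coe_insert, Set.Finite.coe_toFinset]
    refine Or.inr fun h0 => hc ?_
    simp only at h0 ⊢
    rw [h0, smul_zero]

theorem exists_prod_map_eq_smul_of_perm (hcomm : ∀ p q, ∃ c : ℂ, v p * v q = c • (v q * v p))
    {w w' : List ℤ} (h : w.Perm w') : ∃ c : ℂ, (w.map v).prod = c • (w'.map v).prod := by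
  induction h with
  | nil => exact ⟨1, by simp⟩
  | cons p _ ih =>
    obtain ⟨c, hc⟩ := ih
    exact ⟨c, by rw [List.map_cons, List.prod_cons, hc, mul_smul_comm, List.map_cons,
      List.prod_cons]⟩
  | swap p q w =>
    obtain ⟨c, hc⟩ := hcomm q p
    refine ⟨c, ?_⟩
    simp only [List.map_cons, List.prod_cons]
    rw [← mul_assoc, hc, smul_mul_assoc, mul_assoc]
  | trans _ _ ih ih' =>
    obtain ⟨c, hc⟩ := ih
    obtain ⟨c', hc'⟩ := ih'
    exact ⟨c * c', by rw [hc, hc', smul_smul]⟩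

/-- The cross terms are nonnegative. This bounds the sum of squares during straightening. -/
theorem sum_map_sq_le_sq_sum {w : List ℤ} (hw : ∀ i ∈ w, 0 ≤ i) :
    (w.map (· ^ 2)).sum ≤ w.sum ^ 2 := by
  induction w with
  | nil => simp
  | cons a w ih =>
    have h1 := ih fun i hi => hw i (List.mem_cons_of_mem _ hi)
    have h2 : 0 ≤ w.sum := List.sum_nonneg fun i hi => hw i (List.mem_cons_of_mem _ hi)
    have h3 := mul_nonneg (hw a List.mem_cons_self) h2
    simp only [List.map_cons, List.sum_cons]
    nlinarith

theorem prod_map_apply_mem_span (hcomm : ∀ p q, ∃ c : ℂ, v p * v q = c • (v q * v p))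
    (hfin : ∀ n x, (Function.support fun a : ℤ => v a (v (n - a) x)).Finite)
    (hrel : ∀ (P : Polynomial ℂ), P.natDegree < L → ∀ n x,
      ∑ᶠ a : ℤ, P.eval (a : ℂ) • v a (v (n - a) x) = 0)
    {d : ℤ} {ω : M} (hω : ∀ p < d, v p ω = 0) (w : List ℤ) :
    (w.map v).prod ω ∈ Submodule.span ℂ {y | ∃ w : List ℤ,
      w.IsChain (fun a b => (L : ℤ) ≤ a - b) ∧ (∀ i ∈ w, d ≤ i) ∧ y = (w.map v).prod ω} := by
  set F := Submodule.span ℂ {y | ∃ w : List ℤ,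
      w.IsChain (fun a b => (L : ℤ) ≤ a - b) ∧ (∀ i ∈ w, d ≤ i) ∧ y = (w.map v).prod ω} with hF
  -- The measure `(∑ (i - d))² + 1 - ∑ (i - d)²` is positive when all indices are at least `d`; it
  -- drops at each rewriting.
  suffices h : ∀ (t : ℕ) (w : List ℤ), (w.map (· - d)).sum ^ 2 + 1 -
      ((w.map (· - d)).map (· ^ 2)).sum ≤ t → (w.map v).prod ω ∈ F from
    h _ w (Int.self_le_toNat _)
  intro t
  induction t with
  | zero =>
    intro w hw
    by_cases hd : ∀ i ∈ w, d ≤ i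
    · have := sum_map_sq_le_sq_sum (w := w.map (· - d)) (by simpa using hd)
      push_cast at hw
      linarith
    · push Not at hd
      obtain ⟨p, hp, hpd⟩ := hd
      -- A mode with index below `d`, moved to the right end, kills `ω`.
      obtain ⟨c, hc⟩ := exists_prod_map_eq_smul_of_perm hcomm
        ((List.perm_cons_erase hp).trans (List.perm_append_singleton p (w.erase p)).symm)
      rw [hc]
      simp [hω p hpd]
  | succ t ih =>
    intro w hw
    by_cases hd : ∀ i ∈ w, d ≤ i
    · have hperm := List.perm_insertionSort (fun a b : ℤ => b ≤ a) w
      have hsort := List.pairwise_insertionSort (fun a b : ℤ => b ≤ a) w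
      set w' := w.insertionSort (fun a b : ℤ => b ≤ a) with hw'
      obtain ⟨c, hc⟩ := exists_prod_map_eq_smul_of_perm hcomm hperm.symm
      rw [hc, LinearMap.smul_apply]
      refine F.smul_mem c ?_
      rw [← (hperm.map (· - d)).sum_eq, ← ((hperm.map (· - d)).map (· ^ 2)).sum_eq] at hw
      by_cases hchain : w'.IsChain (fun a b => (L : ℤ) ≤ a - b)
      · exact Submodule.subset_span ⟨w', hchain, fun i hi => hd i (hperm.mem_iff.1 hi), rfl⟩
      rw [List.isChain_iff_forall_rel_of_append_cons_cons] at hchain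
      push Not at hchain
      obtain ⟨a, b, u, s, hs, hab⟩ := hchain
      rw [hs] at hw hsort ⊢
      have hba : b ≤ a := (List.pairwise_cons.1 (List.pairwise_append.1 hsort).2.1).1 b
        List.mem_cons_self
      have habL : |a - b| < L := by rw [abs_of_nonneg (by omega)]; omega
      suffices hle : Submodule.span ℂ {y | ∃ c e : ℤ, c + e = a + b ∧ (L : ℤ) ≤ |c - e| ∧
          y = v c (v e ((s.map v).prod ω))} ≤ F.comap (u.map v).prod by
        have := hle (mem_span_of_abs_sub_lt hfin hrel habL ((s.map v).prod ω))
        simpa using this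
      rw [Submodule.span_le]
      rintro _ ⟨c, e, hce, hL, rfl⟩
      have := ih (u ++ c :: e :: s) (by
        simp only [List.map_append, List.map_cons, List.sum_append, List.sum_cons] at hw ⊢
        have h1 : (a - b) ^ 2 < (c - e) ^ 2 := sq_lt_sq.2 (lt_of_lt_of_le habL hL)
        -- With the sum of two numbers fixed, their squares add up to more as their distance grows.
        have h2 : (c - d) ^ 2 + (e - d) ^ 2 > (a - d) ^ 2 + (b - d) ^ 2 := by
          obtain rfl : e = a + b - c := by linarith
          nlinarith
        have h3 : c - d + (e - d + (s.map (· - d)).sum) =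
          a - d + (b - d + (s.map (· - d)).sum) := by linarith
        rw [h3]
        push_cast at hw
        linarith)
      simpa using this
    · push Not at hd
      obtain ⟨p, hp, hpd⟩ := hd
      obtain ⟨c, hc⟩ := exists_prod_map_eq_smul_of_perm hcomm
        ((List.perm_cons_erase hp).trans (List.perm_append_singleton p (w.erase p)).symm)
      rw [hc]
      simp [hω p hpd]

end Spanning

/-! ### The three descriptions of the basic subspaces -/

section BasicSubspaces

theorem applyTo_mono {A B : Submodule ℂ (Module.End ℂ Space)} (h : A ≤ B) (x : Space) :
    applyTo A x ≤ applyTo B x :=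
  Submodule.map_mono h

theorem polyOps_mono (x : ℤ → Module.End ℂ Space) {S T : Set ℤ} (h : S ⊆ T) :
    polyOps x S ≤ polyOps x T :=
  Algebra.adjoin_mono (Set.image_mono h)

theorem fibOps_le_polyOps (l : ℤ) (x : ℤ → Module.End ℂ Space) (S : Set ℤ) :
    fibOps l x S ≤ polyOps x S := by
  refine Submodule.span_le.2 ?_
  rintro _ ⟨w, -, hw, rfl⟩
  refine Subalgebra.list_prod_mem _ fun y hy => ?_
  obtain ⟨i, hi, rfl⟩ := List.mem_map.1 hy
  exact Algebra.subset_adjoin ⟨i, hw i hi, rfl⟩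

theorem polyOps_univ_le {x : ℤ → Module.End ℂ Space} {A : Submodule ℂ (Module.End ℂ Space)}
    (h : ∀ w : List ℤ, (w.map x).prod ∈ A) : polyOps x Set.univ ≤ A := by
  rw [polyOps, Algebra.adjoin_eq_span, Submodule.span_le]
  intro y hy
  obtain ⟨l, hl, rfl⟩ := Submonoid.exists_list_of_mem_closure hy
  have : ∃ w : List ℤ, w.map x = l := by
    clear hy
    induction l with
    | nil => exact ⟨[], rfl⟩
    | cons a l ih =>
      obtain ⟨i, -, rfl⟩ := hl a List.mem_cons_self
      obtain ⟨w, rfl⟩ := ih fun y hy => hl y (List.mem_cons_of_mem _ hy)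
      exact ⟨i :: w, rfl⟩
  obtain ⟨w, rfl⟩ := this
  exact h w

/-- The reflection `n = c - p` turns descending words with gaps at least `L` and `p ≥ jL` into
Fibonacci-`(L - 1)` words with indices at most `c - jL`. -/
theorem applyTo_polyOps_univ_le (L : ℕ) (j c : ℤ) :
    applyTo (polyOps (fun n => vertexCoeff L (c - n)) Set.univ) (vac j) ≤
      applyTo (fibOps (L - 1) (fun n => vertexCoeff L (c - n)) (Set.Iic (c - j * L)))
        (vac j) := by
  refine Submodule.map_le_iff_le_comap.2 (polyOps_univ_le fun w => ?_)
  have h := prod_map_apply_mem_span (v := vertexCoeff L)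
    (fun p q => ⟨_, vertexCoeff_mul_comm L p q⟩) (finite_support_vertexCoeff L)
    (fun P hP n x => finsum_eval_smul_vertexCoeff hP n x)
    (fun p (hp : p < j * L) => vertexCoeff_vac L hp) (w.map (c - ·))
  rw [List.map_map] at h
  refine (Submodule.span_le.2 ?_ : _ ≤ applyTo _ _) h
  rintro _ ⟨u, hu, hud, rfl⟩
  refine Submodule.mem_map.2 ⟨(u.map (vertexCoeff L)).prod,
    Submodule.subset_span ⟨u.map (c - ·), ?_, ?_, ?_⟩, rfl⟩
  · rw [IsFibonacci, List.isChain_map]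
    exact hu.imp fun a b hab => by omega
  · intro i hi
    obtain ⟨p, hp, rfl⟩ := List.mem_map.1 hi
    have := hud p hp
    simp only [Set.mem_Iic]
    omega
  · rw [List.map_map]
    congr 2
    ext1 p
    simp

theorem applyTo_polyOps_eq (L : ℕ) (j c : ℤ) :
    applyTo (polyOps (fun n => vertexCoeff L (c - n)) Set.univ) (vac j) =
        applyTo (polyOps (fun n => vertexCoeff L (c - n)) (Set.Iic (c - j * L))) (vac j) ∧
      applyTo (polyOps (fun n => vertexCoeff L (c - n)) (Set.Iic (c - j * L))) (vac j) =
        applyTo (fibOps (L - 1) (fun n => vertexCoeff L (c - n)) (Set.Iic (c - j * L)))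
          (vac j) := by
  have h1 := applyTo_polyOps_univ_le L j c
  have h2 := applyTo_mono (fibOps_le_polyOps (L - 1) (fun n => vertexCoeff L (c - n))
    (Set.Iic (c - j * L))) (vac j)
  have h3 := applyTo_mono (polyOps_mono (fun n => vertexCoeff L (c - n))
    (Set.subset_univ (Set.Iic (c - j * L)))) (vac j)
  exact ⟨le_antisymm (h1.trans h2) h3, le_antisymm (h3.trans h1) h2⟩

end BasicSubspaces

end LatticeVA

end

theorem mainTheorem2 :
    (∀ (N : ℕ), 1 ≤ N → ∀ (j : ℤ),
      LatticeVA.basicEven N j =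
          LatticeVA.applyTo (LatticeVA.polyOps (LatticeVA.e N) (Set.Iic (-2 * N * j - N)))
            (LatticeVA.vac j) ∧
        LatticeVA.applyTo (LatticeVA.polyOps (LatticeVA.e N) (Set.Iic (-2 * N * j - N)))
            (LatticeVA.vac j) =
          LatticeVA.applyTo
            (LatticeVA.fibOps (2 * N - 1) (LatticeVA.e N) (Set.Iic (-2 * N * j - N)))
            (LatticeVA.vac j)) ∧
    (∀ (N : ℕ) (j : ℤ),
      LatticeVA.basicOdd N j =
          LatticeVA.applyTo (LatticeVA.polyOps (LatticeVA.θ N) (Set.Iic (-j * (2 * N + 1))))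
            (LatticeVA.vac j) ∧
        LatticeVA.applyTo (LatticeVA.polyOps (LatticeVA.θ N) (Set.Iic (-j * (2 * N + 1))))
            (LatticeVA.vac j) =
          LatticeVA.applyTo
            (LatticeVA.fibOps (2 * N) (LatticeVA.θ N) (Set.Iic (-j * (2 * N + 1))))
            (LatticeVA.vac j)) := by
  constructor
  · intro N _ j
    have h := LatticeVA.applyTo_polyOps_eq (2 * N) j (-N)
    have he : (fun n : ℤ => LatticeVA.vertexCoeff (2 * N) (-(N : ℤ) - n)) = LatticeVA.e N := by
      funext n
      rw [LatticeVA.e, neg_sub_comm, sub_eq_add_neg, add_comm, ← sub_eq_add_neg]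
    have hd : -(N : ℤ) - j * (2 * N : ℕ) = -2 * N * j - N := by push_cast; ring
    have hl : (2 * N : ℕ) - (1 : ℤ) = 2 * N - 1 := by push_cast; ring
    rw [he, hd, hl] at h
    exact h
  · intro N j
    have h := LatticeVA.applyTo_polyOps_eq (2 * N + 1) j 0
    have he : (fun n : ℤ => LatticeVA.vertexCoeff (2 * N + 1) (0 - n)) = LatticeVA.θ N := by
      funext n
      rw [LatticeVA.θ, zero_sub]
    have hd : (0 : ℤ) - j * (2 * N + 1 : ℕ) = -j * (2 * N + 1) := by push_cast; ring
    have hl : (2 * N + 1 : ℕ) - (1 : ℤ) = 2 * N := by push_cast; ring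
    rw [he, hd, hl] at h
    exact h
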